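/- Let $k$ be a field. Let $\mathcal A'$ be a locally noetherian Grothendieck abelian category (the noetherian objects generate), and let $\mathcal A$ be an abelian $k$-linear category with finite-dimensional Hom-spaces, identified through a fully faithful exact functor $\mathcal A\to\mathcal A'$ with the full subcategory of noetherian objects of $\mathcal A'$. (For example $\mathcal A=\operatorname{mod}\Lambda\subseteq\mathcal A'=\operatorname{Mod}\Lambda$ for a finite-dimensional $k$-algebra $\Lambda$; or a noetherian abelian $k$-category $\mathcal A$ of finite homological dimension with Hom-finite $D^b(\mathcal A)$ that is the category of noetherian objects of a locally noetherian Grothendieck $k$-category $\mathcal A'$ of finite homological dimension.) Let $T\in\mathcal A$, let $\widehat{\mathcal B}=\operatorname{mod}(\operatorname{End}(T)^{op})$ be the category of finitely generated $\operatorname{End}(T)^{op}$-modules, and suppose that $T$ is a tilting object of homological dimension $2$ in the following sense: $R\mathrm{Hom}(T,-)$ (the right derived functor of $\mathrm{Hom}(T,-)$, computed with injective resolutions in $\mathcal A'$) induces an equivalence of triangulated categories $F=R\mathrm{Hom}(T,-):D^b(\mathcal A)\to D^b(\widehat{\mathcal B})$, and $H^iF(X)=\mathrm{Ext}^i(T,X)=0$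 for all $X\in\mathcal A$ and $i\ge 3$. Regard $\mathcal A$ and $\widehat{\mathcal B}$ as full subcategories, closed under isomorphism, of $D^b(\mathcal A)$ and $D^b(\widehat{\mathcal B})$ (complexes concentrated in degree $0$), and put $\mathcal B=F^{-1}(\widehat{\mathcal B})\subseteq D^b(\mathcal A)$. Write $\Sigma$ for the suspension, and for full subcategories $\mathcal X,\mathcal Z$ of $D^b(\mathcal A)$ let $\mathcal X*\mathcal Z$ be the full subcategory of all $y$ admitting a triangle $x\to y\to z\to\Sigma x$ with $x\in\mathcal X$, $z\in\mathcal Z$. Then $$\mathcal A\subseteq\mathcal B*\Sigma^{-1}\mathcal B*\Sigma^{-2}\mathcal B\qquad\text{and}\qquad \mathcal B\subseteq\Sigma^{2}\mathcal A*\Sigma\mathcal A*\mathcal A .$$ Consequently the filtration theorem of Jensen, Madsen and Su holds. Namely, put $\mathcal F^i=\{x\in\mathcal A\mid H^jF(x)=0\text{ for }j\ne i\}$; then $\mathcal F^i=\mathcal A\cap\Sigma^{-i}\mathcal B$ for all $i$. Define $\mathcal E_0=\langle\mathrm{Gen}(\mathcal F^0)\rangle$, $\mathcal E_1=\mathcal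 F^1$ and $\mathcal E_2=\langle\mathrm{Sub}(\mathcal F^2)\rangle$, where $\mathrm{Gen}(S)$ and $\mathrm{Sub}(S)$ consist of the quotients and the subobjects in $\mathcal A$ of objects of $S$, and $\langle S\rangle$ of the objects with a finite filtration with all subquotients in $S\cup\{0\}$. Then $\mathcal E_0,\mathcal E_1,\mathcal E_2$ are closed under extensions, $\mathrm{Hom}(\mathcal E_i,\mathcal E_j)=0$ for $i<j$, and every $x\in\mathcal A$ has a unique filtration by subobjects $0=x_0\subseteq x_1\subseteq x_2\subseteq x_3=x$ with $x_{i+1}/x_i\in\mathcal E_i$ for $i=0,1,2$. -/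

import Mathlib

open CategoryTheory CategoryTheory.Limits CategoryTheory.Pretriangulated

universe w w' w₁ w₂ w₃ w₄ v u u'

noncomputable section

namespace JMS

/-! ### Classes of objects in an abelian category -/

section Abelian

variable {C : Type u} [Category.{v} C] [Abelian C]

/-- The subquotient `q / p` attached to subobjects `p ≤ q` of `x`. -/
def subquotient {x : C} {p q : Subobject x} (h : p ≤ q) : C :=
  cokernel (Subobject.ofLE p q h)

/-- `Gen S`: the objects `x` which admit an epimorphism `s ↠ x` with `s ∈ S`. -/
def gen (S : ObjectProperty C) : ObjectProperty C :=
  fun x => ∃ (s : C) (_ : S s) (f : s ⟶ x), Epi f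

/-- `Sub S`: the objects `x` which admit a monomorphism `x ↣ s` with `s ∈ S`. -/
def sub (S : ObjectProperty C) : ObjectProperty C :=
  fun x => ∃ (s : C) (_ : S s) (f : x ⟶ s), Mono f

/-- The extension closure `⟨S⟩`: the objects `a` having a finite filtration
`0 = a₀ ⊆ a₁ ⊆ ⋯ ⊆ aₙ = a` all of whose subquotients `aᵢ₊₁ / aᵢ` lie in `S ∪ {0}`. -/
def extClosure (S : ObjectProperty C) : ObjectProperty C :=
  fun a => ∃ (n : ℕ) (p : ℕ → Subobject a) (hp : Monotone p), p 0 = ⊥ ∧ p n = ⊤ ∧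
    ∀ i < n, S (subquotient (hp (Nat.le_succ i))) ∨ IsZero (subquotient (hp (Nat.le_succ i)))

end Abelian

/-! ### The bounded derived category -/

section Derived

variable (C : Type u) [Category.{v} C] [Abelian C] [HasDerivedCategory.{w} C]

/-- `D^b(C)`: the full subcategory of `D(C)` of complexes with bounded cohomology. -/
abbrev Db : Type (max u v) :=
  (DerivedCategory.TStructure.t (C := C)).bounded.FullSubcategory

/-- The inclusion `D^b(C) ⥤ D(C)`. -/
abbrev Db.ι : Db C ⥤ DerivedCategory C :=
  (DerivedCategory.TStructure.t (C := C)).bounded.ι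

/-- The embedding `C ⥤ D^b(C)` as complexes concentrated in degree `0`. -/
def Db.single : C ⥤ Db C :=
  (DerivedCategory.TStructure.t (C := C)).bounded.lift (DerivedCategory.singleFunctor C 0)
    (fun _ => ⟨⟨0, inferInstance⟩, ⟨0, inferInstance⟩⟩)

/-- The cohomology functor `H^i : D^b(C) ⥤ C`. -/
def Db.homology (i : ℤ) : Db C ⥤ C :=
  Db.ι C ⋙ DerivedCategory.homologyFunctor C i

/-- `C` as a full, isomorphism-closed subcategory of `D^b(C)`. -/
def Db.heart : ObjectProperty (Db C) := (Db.single C).essImage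

end Derived

/-- `Σⁿ P`, the full subcategory of objects isomorphic to `Σⁿ x = x⟦n⟧` with `x ∈ P`. -/
def sigma {D : Type u} [Category.{v} D] [HasShift D ℤ] (n : ℤ) (P : ObjectProperty D) :
    ObjectProperty D :=
  P.map (shiftFunctor D n)

section ExactFunctor

variable {C : Type u} [Category.{v} C] [Abelian C] [HasDerivedCategory.{w} C]
  {C' : Type u'} [Category.{v} C'] [Abelian C'] [HasDerivedCategory.{w'} C']

/-- The functor `D^b(C) ⥤ D^+(C')` induced by an exact functor `C ⥤ C'`. -/
def dbToPlus (J : C ⥤ C') [J.Additive] [PreservesFiniteLimits J] [PreservesFiniteColimits J] :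
    Db C ⥤ DerivedCategory.Plus C' :=
  (DerivedCategory.TStructure.t (C := C')).plus.lift (Db.ι C ⋙ J.mapDerivedCategory) (by
    rintro ⟨X, ⟨n, hX⟩, -⟩
    obtain ⟨K, e, hK⟩ := hX.ge
    refine ⟨n, ⟨(J.mapHomologicalComplex (ComplexShape.up ℤ)).obj K,
      J.mapDerivedCategory.mapIso e ≪≫ J.mapDerivedCategoryFactors.app K, ?_⟩⟩
    infer_instance)

end ExactFunctor

/-! ### `mod (End T)ᵒᵖ` and `RHom(T, -)` -/

section ModEndOp

theorem isNoetherianRing_endOp (k : Type w') [Field k] {C : Type u} [Category.{v} C] [Abelian C]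
    [Linear k C] [∀ X Y : C, Module.Finite k (X ⟶ Y)] (T : C) :
    IsNoetherianRing (End T)ᵐᵒᵖ := by
  have h : Module.Finite k (End T) := inferInstanceAs (Module.Finite k (T ⟶ T))
  have h' : Module.Finite k (End T)ᵐᵒᵖ := Module.Finite.equiv (MulOpposite.opLinearEquiv k)
  exact isNoetherian_of_tower k inferInstance

/-- `mod (End T)ᵒᵖ`: finitely generated left modules over the opposite ring of `End T`
(whose multiplication is composition, `f * g = f ∘ g`). The field `k` is only recorded
because it is the reason why `End T` is noetherian. -/
def ModEndOp (k : Type w') [Field k] {C : Type u} [Category.{v} C] [Abelian C] [Linear k C]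
    [∀ X Y : C, Module.Finite k (X ⟶ Y)] (T : C) : Type (v + 1) :=
  FGModuleCat.{v} (End T)ᵐᵒᵖ

variable (k : Type w') [Field k] {C : Type u} [Category.{v} C] [Abelian C] [Linear k C]
  [∀ X Y : C, Module.Finite k (X ⟶ Y)]

instance (T : C) : Category.{v} (ModEndOp k T) :=
  inferInstanceAs (Category.{v} (FGModuleCat.{v} (End T)ᵐᵒᵖ))

instance (T : C) : Abelian (ModEndOp k T) :=
  haveI := isNoetherianRing_endOp k T
  inferInstanceAs (Abelian (FGModuleCat.{v} (End T)ᵐᵒᵖ))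

/-- The inclusion of `mod (End T)ᵒᵖ` into the category of all `(End T)ᵒᵖ`-modules. -/
def ModEndOp.ι (T : C) : ModEndOp k T ⥤ ModuleCat.{v} (End T)ᵐᵒᵖ :=
  forget₂ (FGModuleCat.{v} (End T)ᵐᵒᵖ) (ModuleCat.{v} (End T)ᵐᵒᵖ)

instance (T : C) : (ModEndOp.ι k T).Additive where
  map_add := by intros; rfl

instance (T : C) : PreservesFiniteLimits (ModEndOp.ι k T) :=
  haveI := isNoetherianRing_endOp k T
  inferInstanceAs (PreservesFiniteLimits
    (forget₂ (FGModuleCat.{v} (End T)ᵐᵒᵖ) (ModuleCat.{v} (End T)ᵐᵒᵖ)))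

instance (T : C) : PreservesFiniteColimits (ModEndOp.ι k T) :=
  haveI := isNoetherianRing_endOp k T
  inferInstanceAs (PreservesFiniteColimits
    (forget₂ (FGModuleCat.{v} (End T)ᵐᵒᵖ) (ModuleCat.{v} (End T)ᵐᵒᵖ)))

end ModEndOp

section RHom

variable {C : Type u} [Category.{v} C] [Abelian C]
  {C' : Type u'} [Category.{v} C'] [Abelian C']

/-- The ring homomorphism `(End T)ᵒᵖ → (End (J T))ᵒᵖ` given by a functor `J`. -/
def endOpMap (J : C ⥤ C') [J.Additive] (T : C) : (End T)ᵐᵒᵖ →+* (End (J.obj T))ᵐᵒᵖ :=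
  RingHom.op
    { J.mapEnd T with
      map_zero' := J.map_zero T T
      map_add' := fun _ _ => J.map_add }

/-- The functor `Hom(J T, -) : C' ⥤ Mod (End T)ᵒᵖ`, where `End T` acts by precomposition. -/
def homFunctor (J : C ⥤ C') [J.Additive] (T : C) : C' ⥤ ModuleCat.{v} (End T)ᵐᵒᵖ :=
  preadditiveCoyonedaObj (J.obj T) ⋙ ModuleCat.restrictScalars (endOpMap J T)

instance (J : C ⥤ C') [J.Additive] (T : C) : (homFunctor J T).Additive := by
  unfold homFunctor
  infer_instance

/-- The total right derived functor `RHom(T, -) : D^+(C') ⥤ D^+(Mod (End T)ᵒᵖ)`,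
computed with injective resolutions in `C'`. -/
def rHom [EnoughInjectives C'] [HasDerivedCategory.{w₁} C'] (J : C ⥤ C') [J.Additive] (T : C)
    [HasDerivedCategory.{w₂} (ModuleCat.{v} (End T)ᵐᵒᵖ)] :
    DerivedCategory.Plus C' ⥤ DerivedCategory.Plus (ModuleCat.{v} (End T)ᵐᵒᵖ) :=
  (homFunctor J T).rightDerivedFunctorPlus

end RHom

/-! ### The classes attached to a functor `F : D^b(C) ⥤ D^b(D)` -/

section Classes

variable {C : Type u} [Category.{v} C] [Abelian C] [HasDerivedCategory.{w} C]
  {D : Type u'} [Category.{v} D] [Abelian D] [HasDerivedCategory.{w'} D]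

/-- `F⁻¹(D)`: the full subcategory of `D^b(C)` of objects sent by `F` into `D ⊆ D^b(D)`. -/
def pullbackHeart (F : Db C ⥤ Db D) : ObjectProperty (Db C) :=
  (Db.heart D).inverseImage F

/-- `𝓕ⁱ = {x ∈ C ∣ H^j(F x) = 0 for all j ≠ i}`. -/
def concentrated (F : Db C ⥤ Db D) (i : ℤ) : ObjectProperty C :=
  fun x => ∀ j : ℤ, j ≠ i → IsZero ((Db.homology D j).obj (F.obj ((Db.single C).obj x)))

/-- `𝓔₀ = ⟨Gen 𝓕⁰⟩`, `𝓔₁ = 𝓕¹`, `𝓔₂ = ⟨Sub 𝓕²⟩`. -/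
def filtClass (F : Db C ⥤ Db D) : Fin 3 → ObjectProperty C :=
  ![extClosure (gen (concentrated F 0)), concentrated F 1, extClosure (sub (concentrated F 2))]

end Classes

end JMS

end

open JMS

/-!
The standard t-structure of `D^b(ℬ̂)` is transported along `F` to a t-structure on `D^b(𝒜)` with
heart `ℬ`. Its position relative to the standard one is that of a tilt in amplitude `[0, 2]`:
objects of `𝒜` have `ℬ`-cohomology only in degrees `0, 1, 2`, the vanishing in negative degrees
being left exactness of `RHom(T, -)`. By orthogonality, objects of `ℬ` then have ordinary
cohomology only in degrees `-2, -1, 0`, and both inclusions follow by truncating twice.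

For the filtration of `x`, let `x₁` be the largest subobject in `⟨Gen 𝓕⁰⟩`, which exists since `x`
is noetherian. The quotient `y = x / x₁` receives no nonzero morphism from `𝓕⁰`, so it has
`ℬ`-cohomology only in degrees `1, 2`: there is a triangle `b → y → w` with `b ∈ Σ⁻¹ℬ` and
`w ∈ 𝓕²`. The kernel `m` of `y → w` satisfies `y / m ∈ Sub 𝓕²`, and the degree `1` part `b'` of `m`
is a subobject of `b` in `Σ⁻¹ℬ`. If `b' = b` then `m ∈ 𝓕¹`; otherwise repeat with `m` in place of
`y`, which terminates because finite-dimensional modules are artinian. Uniqueness follows from the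
vanishing of morphisms between the classes.
-/

noncomputable section

namespace JMS

section Subquotients

open scoped ZeroObject

variable {C : Type u} [Category.{v} C] [Abelian C]

lemma shortExact_pullback {S : ShortComplex C} (hS : S.ShortExact) {z : C} (i : z ⟶ S.X₃) :
    (ShortComplex.mk (pullback.lift S.f (0 : S.X₁ ⟶ z) (by rw [S.zero, zero_comp]))
      (pullback.snd S.g i) (pullback.lift_snd ..)).ShortExact := by
  have := hS.mono_f
  have := hS.epi_g
  have hfst : pullback.lift S.f (0 : S.X₁ ⟶ z) (by rw [S.zero, zero_comp]) ≫
      pullback.fst S.g i = S.f := pullback.lift_fst ..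
  have hmono := mono_of_mono_fac hfst
  refine
    { exact := ShortComplex.exact_of_f_is_kernel _ (KernelFork.IsLimit.ofι' _ _ fun k hk => ?_)
      mono_f := hmono
      epi_g := inferInstanceAs (Epi (pullback.snd S.g i)) }
  have hk' : (k ≫ pullback.fst S.g i) ≫ S.g = 0 := by
    rw [Category.assoc, pullback.condition, reassoc_of% hk, zero_comp]
  refine ⟨hS.exact.lift _ hk', pullback.hom_ext ?_ ?_⟩
  · rw [Category.assoc, hfst, hS.exact.lift_f]
  · rw [Category.assoc, pullback.lift_snd, comp_zero, hk]

lemma shortExact_pullback_fst {S : ShortComplex C} (hS : S.ShortExact) {y : C} (g : y ⟶ S.X₂)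
    [Epi g] :
    (ShortComplex.mk (pullback.fst g S.f) (g ≫ S.g) (by
      rw [pullback.condition_assoc, S.zero, comp_zero])).ShortExact := by
  have := hS.mono_f
  have := hS.epi_g
  refine
    { exact := ShortComplex.exact_of_f_is_kernel _ (KernelFork.IsLimit.ofι' _ _ fun k hk => ?_)
      mono_f := inferInstanceAs (Mono (pullback.fst g S.f))
      epi_g := epi_comp g S.g }
  have hk' : (k ≫ g) ≫ S.g = 0 := by simpa using hk
  exact ⟨pullback.lift k (hS.exact.lift _ hk') (by simp), pullback.lift_fst ..⟩

/-- The projection `q ↠ q / p`. -/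
def subquotientπ {x : C} {p q : Subobject x} (h : p ≤ q) : (q : C) ⟶ subquotient h :=
  cokernel.π (Subobject.ofLE p q h)

lemma ofLE_comp_subquotientπ {x : C} {p q : Subobject x} (h : p ≤ q) :
    Subobject.ofLE p q h ≫ subquotientπ h = 0 :=
  cokernel.condition _

lemma shortExact_subquotient {x : C} {p q : Subobject x} (h : p ≤ q) :
    (ShortComplex.mk _ _ (ofLE_comp_subquotientπ h)).ShortExact :=
  { exact := ShortComplex.exact_cokernel _
    epi_g := inferInstanceAs (Epi (cokernel.π (Subobject.ofLE p q h))) }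

lemma nonempty_subquotient_iso {x : C} {p q : Subobject x} (h : p ≤ q) {S : ShortComplex C}
    (hS : S.Exact) [Mono S.f] [Epi S.g] (j : S.X₂ ⟶ x) [Mono j]
    (hp : p = Subobject.mk (S.f ≫ j)) (hq : q = Subobject.mk j) :
    Nonempty (subquotient h ≅ S.X₃) := by
  subst hp hq
  let e₁ := Subobject.underlyingIso (S.f ≫ j)
  let e₂ := Subobject.underlyingIso j
  have comm : Subobject.ofLE _ _ h ≫ e₂.hom = e₁.hom ≫ S.f := by
    rw [← cancel_mono j]
    simp [e₁, e₂]
  exact ⟨cokernel.mapIso _ _ e₁ e₂ comm ≪≫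
    (cokernelIsCokernel S.f).coconePointUniqueUpToIso hS.gIsCokernel⟩

lemma nonempty_subquotient_bot_iso {x : C} (p : Subobject x) :
    Nonempty (subquotient (bot_le : ⊥ ≤ p) ≅ (p : C)) := by
  let S : ShortComplex C := .mk (0 : (0 : C) ⟶ p) (𝟙 _) zero_comp
  have hS : S.Exact := (S.exact_iff_mono rfl).2 inferInstance
  have : Mono S.f := inferInstanceAs (Mono (0 : (0 : C) ⟶ p))
  have : Epi S.g := inferInstanceAs (Epi (𝟙 _))
  exact nonempty_subquotient_iso _ hS p.arrow
    (by simp only [S, zero_comp, Subobject.bot_eq_zero]) (by simp only [Subobject.mk_arrow, S])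

lemma isZero_subquotient_self {x : C} (p : Subobject x) : IsZero (subquotient (le_refl p)) := by
  have : Epi (Subobject.ofLE p p le_rfl) := by
    rw [Subobject.ofLE_refl]
    infer_instance
  exact isZero_cokernel_of_epi _

lemma exists_subobject_of_mono_cokernel {x : C} (p : Subobject x) {m : C}
    (j : m ⟶ cokernel p.arrow) [Mono j] :
    ∃ (q : Subobject x) (h : p ≤ q), Nonempty (subquotient h ≅ m) ∧
      Nonempty (subquotient (le_top : q ≤ ⊤) ≅ cokernel j) := by
  let S : ShortComplex C := .mk p.arrow (cokernel.π p.arrow) (cokernel.condition _)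
  have hS : S.ShortExact := { exact := ShortComplex.exact_cokernel _ }
  let T : ShortComplex C := .mk j (cokernel.π j) (cokernel.condition _)
  have hT : T.ShortExact := { exact := ShortComplex.exact_cokernel _ }
  have hS' := shortExact_pullback hS j
  have hT' := shortExact_pullback_fst hT S.g
  have := hS'.mono_f
  have := hS'.epi_g
  have := hT'.mono_f
  have := hT'.epi_g
  let l : (p : C) ⟶ pullback S.g j := pullback.lift p.arrow 0 (by simp [S])
  have hl : l ≫ pullback.fst S.g j = p.arrow := pullback.lift_fst ..
  have hp : p = Subobject.mk (l ≫ pullback.fst S.g j) := by simp only [hl, Subobject.mk_arrow]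
  have hpq : p ≤ Subobject.mk (pullback.fst S.g j) := Subobject.le_mk_of_comm l hl
  exact ⟨_, hpq, nonempty_subquotient_iso _ hS'.exact (pullback.fst S.g j) hp rfl,
    nonempty_subquotient_iso _ hT'.exact (𝟙 x)
      (by simp only [T, S, Category.comp_id])
      (Subobject.top_eq_id x)⟩

lemma le_of_subquotient_hom_eq_zero {x : C} {a b c d : Subobject x} (h : a ≤ b) (h' : c ≤ d)
    (hac : a ≤ c) (hbd : b ≤ d) (H : ∀ f : subquotient h ⟶ subquotient h', f = 0) : b ≤ c := by
  have hab := (shortExact_subquotient h).exact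
  have hcd := (shortExact_subquotient h').exact
  let f : (b : C) ⟶ subquotient h' := Subobject.ofLE b d hbd ≫ subquotientπ h'
  have hf : Subobject.ofLE a b h ≫ f = 0 := by
    rw [← Category.assoc, Subobject.ofLE_comp_ofLE, ← Subobject.ofLE_comp_ofLE a c d hac h',
      Category.assoc, ofLE_comp_subquotientπ, comp_zero]
  have hf₀ : f = 0 := by
    have := (shortExact_subquotient h).epi_g
    rw [← hab.g_desc f hf, H (hab.desc f hf), comp_zero]
  have := (shortExact_subquotient h').mono_f
  refine Subobject.le_of_comm (hcd.lift _ hf₀) ?_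
  calc hcd.lift _ hf₀ ≫ c.arrow
      = (hcd.lift _ hf₀ ≫ Subobject.ofLE c d h') ≫ d.arrow := by simp
    _ = b.arrow := by rw [hcd.lift_f _ hf₀, Subobject.ofLE_arrow]

lemma filtration_le_of_orthogonal {P₀ P₁ P₂ : ObjectProperty C} (h₀₁ : P₀ ≤ P₁.leftOrthogonal)
    (h₀₂ : P₀ ≤ P₂.leftOrthogonal) (h₁₂ : P₁ ≤ P₂.leftOrthogonal) {x : C}
    {p₁ p₂ q₁ q₂ : Subobject x} (hp : p₁ ≤ p₂) (hq : q₁ ≤ q₂)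
    (hp₀ : P₀ (subquotient (bot_le : ⊥ ≤ p₁))) (hp₁ : P₁ (subquotient hp))
    (hq₁ : P₁ (subquotient hq)) (hq₂ : P₂ (subquotient (le_top : q₂ ≤ ⊤))) :
    p₁ ≤ q₁ ∧ p₂ ≤ q₂ := by
  have h : p₁ ≤ q₂ :=
    le_of_subquotient_hom_eq_zero bot_le le_top bot_le le_top fun f => h₀₂ _ hp₀ f hq₂
  exact ⟨le_of_subquotient_hom_eq_zero bot_le hq bot_le h fun f => h₀₁ _ hp₀ f hq₁,
    le_of_subquotient_hom_eq_zero hp le_top h le_top fun f => h₁₂ _ hp₁ f hq₂⟩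

end Subquotients

section ExtensionClosure

open scoped ZeroObject

variable {C : Type u} [Category.{v} C] [Abelian C]

instance (S : ObjectProperty C) : (gen S).IsClosedUnderIsomorphisms where
  of_iso := by
    rintro x y e ⟨s, hs, f, hf⟩
    exact ⟨s, hs, f ≫ e.hom, epi_comp _ _⟩

instance (S : ObjectProperty C) : (sub S).IsClosedUnderIsomorphisms where
  of_iso := by
    rintro x y e ⟨s, hs, f, hf⟩
    exact ⟨s, hs, e.inv ≫ f, mono_comp _ _⟩

lemma extClosure_of_isZero (S : ObjectProperty C) {z : C} (hz : IsZero z) : extClosure S z := by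
  have := Subobject.subsingleton_of_isZero hz
  exact ⟨0, fun _ => ⊥, monotone_const, rfl, Subsingleton.elim _ _, by simp⟩

lemma extClosure_of_shortExact {S : ObjectProperty C} [S.IsClosedUnderIsomorphisms]
    {T : ShortComplex C} (hT : T.ShortExact) (h₁ : extClosure S T.X₁)
    (h₃ : S T.X₃ ∨ IsZero T.X₃) : extClosure S T.X₂ := by
  obtain ⟨n, p, hp, hp₀, hpn, hps⟩ := h₁
  have := hT.mono_f
  have := hT.epi_g
  have of_iso {x y : C} (e : x ≅ y) : (S y ∨ IsZero y) → (S x ∨ IsZero x) :=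
    Or.imp (S.prop_of_iso e.symm) (IsZero.of_iso · e)
  let r (i : ℕ) : Subobject T.X₂ := if i ≤ n then Subobject.mk ((p i).arrow ≫ T.f) else ⊤
  have hr_le {i : ℕ} (hi : i ≤ n) : r i = Subobject.mk ((p i).arrow ≫ T.f) := if_pos hi
  have hr_gt {i : ℕ} (hi : n < i) : r i = ⊤ := if_neg hi.not_ge
  have hr : Monotone r := monotone_nat_of_le_succ fun i => by
    by_cases hi : i + 1 ≤ n
    · rw [hr_le hi, hr_le (i.le_succ.trans hi)]
      exact Subobject.mk_le_mk_of_comm (Subobject.ofLE _ _ (hp i.le_succ)) (by simp)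
    · exact le_top.trans_eq (hr_gt (not_le.1 hi)).symm
  refine ⟨n + 1, r, hr, ?_, hr_gt n.lt_succ_self, fun i hi => ?_⟩
  · have h₀ : (p 0).arrow ≫ T.f = 0 := by rw [hp₀, Subobject.bot_arrow, zero_comp]
    rw [hr_le n.zero_le]
    exact (Subobject.mk_eq_bot_iff_zero ..).2 h₀
  · obtain hin | rfl := Nat.lt_succ_iff_lt_or_eq.1 hi
    · have hQ := shortExact_subquotient (hp i.le_succ)
      have := hQ.mono_f
      have := hQ.epi_g
      obtain ⟨e⟩ := nonempty_subquotient_iso (hr i.le_succ) hQ.exact ((p (i + 1)).arrow ≫ T.f)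
        ((hr_le hin.le).trans (by simp)) (hr_le hin)
      exact of_iso e (hps i hin)
    · have : IsIso (p i).arrow := (Subobject.isIso_arrow_iff_eq_top _).2 hpn
      have hrn : r i = Subobject.mk (T.f ≫ 𝟙 T.X₂) := (hr_le le_rfl).trans
        (Subobject.mk_eq_mk_of_comm _ _ (asIso (p i).arrow) (by simp))
      obtain ⟨e⟩ := nonempty_subquotient_iso (hr i.le_succ) hT.exact (𝟙 T.X₂) hrn
        ((hr_gt i.lt_succ_self).trans (Subobject.top_eq_id _))
      exact of_iso e h₃

lemma le_extClosure (S : ObjectProperty C) [S.IsClosedUnderIsomorphisms] : S ≤ extClosure S := by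
  intro x hx
  let T : ShortComplex C := .mk (0 : (0 : C) ⟶ x) (𝟙 x) zero_comp
  have hT : T.ShortExact :=
    { exact := (T.exact_iff_mono rfl).2 (inferInstanceAs (Mono (𝟙 x)))
      mono_f := inferInstanceAs (Mono (0 : (0 : C) ⟶ x))
      epi_g := inferInstanceAs (Epi (𝟙 x)) }
  exact extClosure_of_shortExact hT (extClosure_of_isZero S (isZero_zero C)) (Or.inl hx)

instance (S : ObjectProperty C) [S.IsClosedUnderIsomorphisms] :
    (extClosure S).IsClosedUnderIsomorphisms where
  of_iso {x y} e hx := by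
    let T : ShortComplex C := .mk e.hom (0 : y ⟶ 0) comp_zero
    have hT : T.ShortExact :=
      { exact := (T.exact_iff_epi rfl).2 (inferInstanceAs (Epi e.hom))
        mono_f := inferInstanceAs (Mono e.hom)
        epi_g := inferInstanceAs (Epi (0 : y ⟶ 0)) }
    exact extClosure_of_shortExact hT hx (Or.inr (isZero_zero C))

lemma extClosure_le_of_shortExact {S P : ObjectProperty C} (h₀ : ∀ z, IsZero z → P z)
    (h : ∀ T : ShortComplex C, T.ShortExact → P T.X₁ → (S T.X₃ ∨ IsZero T.X₃) → P T.X₂) :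
    extClosure S ≤ P := by
  rintro a ⟨n, p, hp, hp₀, hpn, hps⟩
  have hPp (i : ℕ) (hi : i ≤ n) : P (p i : C) := by
    induction i with
    | zero =>
      rw [hp₀]
      exact h₀ _ ((isZero_zero C).of_iso Subobject.botCoeIsoZero)
    | succ i ih =>
      exact h _ (shortExact_subquotient (hp i.le_succ)) (ih (i.le_succ.trans hi)) (hps i hi)
  have : IsIso (p n).arrow := (Subobject.isIso_arrow_iff_eq_top _).2 hpn
  let T : ShortComplex C := .mk (p n).arrow (0 : a ⟶ 0) comp_zero
  have hT : T.ShortExact :=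
    { exact := (T.exact_iff_epi rfl).2 (inferInstanceAs (Epi (p n).arrow))
      mono_f := inferInstanceAs (Mono (p n).arrow)
      epi_g := inferInstanceAs (Epi (0 : a ⟶ 0)) }
  exact h T hT (hPp n le_rfl) (Or.inr (isZero_zero C))

instance (S : ObjectProperty C) [S.IsClosedUnderIsomorphisms] :
    (extClosure S).IsClosedUnderExtensions where
  prop_X₂_of_shortExact {T} hT h₁ h₃ := by
    let P : ObjectProperty C := fun z => ∀ ⦃a y : C⦄ (f : a ⟶ y) (g : y ⟶ z) (w : f ≫ g = 0),
      (ShortComplex.mk f g w).ShortExact → extClosure S a → extClosure S y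
    suffices hP : extClosure S ≤ P from hP _ h₃ _ _ _ hT h₁
    refine extClosure_le_of_shortExact (fun z hz a y f g w hfg ha => ?_)
      fun Q hQ hQ₁ hQ₃ a y f g w hfg ha => ?_
    · exact extClosure_of_shortExact hfg ha (Or.inr hz)
    · have : Epi g := hfg.epi_g
      exact extClosure_of_shortExact (shortExact_pullback_fst hQ g)
        (hQ₁ _ _ _ (shortExact_pullback hfg Q.f) ha) hQ₃

lemma extClosure_gen_le_leftOrthogonal {S P : ObjectProperty C} (h : S ≤ P.leftOrthogonal) :
    extClosure (gen S) ≤ P.leftOrthogonal := by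
  refine extClosure_le_of_shortExact (fun z hz y f _ => hz.eq_of_src f 0)
    fun T hT h₁ h₃ y f hy => ?_
  have hf : T.f ≫ f = 0 := h₁ _ hy
  have := hT.epi_g
  suffices hd : hT.exact.desc f hf = 0 by rw [← hT.exact.g_desc f hf, hd, comp_zero]
  obtain ⟨s, hs, g, _⟩ | hz := h₃
  · exact zero_of_epi_comp g (h _ hs _ hy)
  · exact hz.eq_of_src _ _

lemma le_leftOrthogonal_extClosure_sub {S P : ObjectProperty C} (h : P ≤ S.leftOrthogonal) :
    P ≤ (extClosure (sub S)).leftOrthogonal := by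
  suffices hsub : extClosure (sub S) ≤ P.rightOrthogonal from
    fun x hx y f hy => hsub y hy f hx
  refine extClosure_le_of_shortExact (fun z hz y f _ => hz.eq_of_tgt f 0)
    fun T hT h₁ h₃ y f hy => ?_
  have := hT.mono_f
  have hf : f ≫ T.g = 0 := by
    obtain ⟨s, hs, g, _⟩ | hz := h₃
    · exact zero_of_comp_mono g (h _ hy _ hs)
    · exact hz.eq_of_tgt _ _
  rw [← hT.exact.lift_f f hf, h₁ (hT.exact.lift f hf) hy, zero_comp]

lemma exists_subobject_extClosure_gen (S : ObjectProperty C) (x : C) [IsNoetherianObject x] :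
    ∃ p : Subobject x, extClosure (gen S) (p : C) ∧
      ∀ ⦃s : C⦄, S s → ∀ f : s ⟶ cokernel p.arrow, f = 0 := by
  have : WellFoundedGT (Subobject x) := isNoetherianObject.prop_of_is x
  obtain ⟨p, hp, hmax⟩ := WellFounded.has_min (wellFounded_gt (α := Subobject x))
    {p | extClosure (gen S) (p : C)}
    ⟨⊥, extClosure_of_isZero _ ((isZero_zero C).of_iso Subobject.botCoeIsoZero)⟩
  refine ⟨p, hp, fun s hs f => ?_⟩
  obtain ⟨q, hpq, ⟨e⟩, -⟩ := exists_subobject_of_mono_cokernel p (image.ι f)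
  have hgen : gen S (subquotient hpq) :=
    (gen S).prop_of_iso e.symm ⟨s, hs, factorThruImage f, inferInstance⟩
  have hq : extClosure (gen S) (q : C) :=
    extClosure_of_shortExact (shortExact_subquotient hpq) hp (Or.inl hgen)
  obtain rfl : p = q := hpq.eq_of_not_lt (hmax q hq)
  have him : IsZero (image f) := (isZero_subquotient_self p).of_iso e.symm
  rw [← image.fac f, him.eq_of_tgt (factorThruImage f) 0, zero_comp]

lemma prop_cokernel_comp (P : ObjectProperty C) [P.IsClosedUnderExtensions] {x y z : C}
    (f : x ⟶ y) (g : y ⟶ z) [Mono g] (hf : P (cokernel f)) (hg : P (cokernel g)) :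
    P (cokernel (f ≫ g)) := by
  let K := kernelCokernelCompSequence f g
  have hK : K.Exact := kernelCokernelCompSequence_exact f g
  have hS : (K.sc hK.toIsComplex 3).ShortExact :=
    { exact := hK.exact 3
      mono_f := (ShortComplex.exact_iff_mono _
        ((isZero_kernel_of_mono g).eq_of_src _ _)).1 (hK.exact 2)
      epi_g := inferInstanceAs (Epi (K.map' 4 5)) }
  exact P.prop_X₂_of_shortExact hS hf hg

end ExtensionClosure

section ChainConditions

variable {C : Type u} [Category.{v} C]

lemma wellFounded_mono_not_isIso (h : ∀ X : C, IsArtinianObject X) :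
    WellFounded fun X Y : C => ∃ f : X ⟶ Y, Mono f ∧ ¬ IsIso f := by
  suffices hacc : ∀ (Y : C) (p : Subobject Y) (X : C) (i : X ⟶ Y) [Mono i],
      Subobject.mk i = p → Acc (fun X Y : C => ∃ f : X ⟶ Y, Mono f ∧ ¬ IsIso f) X from
    ⟨fun Y => hacc Y _ Y (𝟙 Y) rfl⟩
  intro Y p
  have := h Y
  induction p using WellFoundedLT.induction with
  | ind p ih =>
    rintro X i _ rfl
    refine ⟨X, fun Z ⟨f, _, hf⟩ => ih _ ?_ Z (f ≫ i) rfl⟩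
    exact Subobject.mk_lt_mk_of_comm f rfl hf

variable {D : Type*} [Category* D] (J : C ⥤ D) [J.Full] [J.Faithful]
  [PreservesFiniteLimits J]

lemma exists_strictMono_subobject (x : C) :
    ∃ φ : Subobject x → Subobject (J.obj x), StrictMono φ := by
  let φ (p : Subobject x) : Subobject (J.obj x) := Subobject.mk (J.map p.arrow)
  have hφ {p q : Subobject x} : φ p ≤ φ q ↔ p ≤ q := by
    constructor
    · intro hpq
      refine Subobject.le_of_comm (J.preimage (Subobject.ofMkLEMk _ _ hpq)) (J.map_injective ?_)
      simp
    · intro hpq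
      refine Subobject.mk_le_mk_of_comm (J.map (Subobject.ofLE p q hpq)) ?_
      rw [← J.map_comp, Subobject.ofLE_arrow]
  exact ⟨φ, strictMono_of_le_iff_le fun _ _ => hφ.symm⟩

lemma isNoetherianObject_of_map (x : C) [IsNoetherianObject (J.obj x)] : IsNoetherianObject x := by
  obtain ⟨φ, hφ⟩ := exists_strictMono_subobject J x
  exact ⟨hφ.wellFoundedGT⟩

lemma isArtinianObject_of_map (x : C) [IsArtinianObject (J.obj x)] : IsArtinianObject x := by
  obtain ⟨φ, hφ⟩ := exists_strictMono_subobject J x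
  exact ⟨hφ.wellFoundedLT⟩

end ChainConditions

section ModEndOp

variable (k : Type w') [Field k] {C : Type u} [Category.{v} C] [Abelian C] [Linear k C]
  [∀ X Y : C, Module.Finite k (X ⟶ Y)]

instance (T : C) : (ModEndOp.ι k T).Full :=
  inferInstanceAs (forget₂ (FGModuleCat.{v} (End T)ᵐᵒᵖ) (ModuleCat.{v} (End T)ᵐᵒᵖ)).Full

instance (T : C) : (ModEndOp.ι k T).Faithful :=
  inferInstanceAs (forget₂ (FGModuleCat.{v} (End T)ᵐᵒᵖ) (ModuleCat.{v} (End T)ᵐᵒᵖ)).Faithful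

include k in
lemma isArtinianRing_endOp (T : C) : IsArtinianRing (End T)ᵐᵒᵖ := by
  have : Module.Finite k (End T) := inferInstanceAs (Module.Finite k (T ⟶ T))
  have : Module.Finite k (End T)ᵐᵒᵖ := Module.Finite.equiv (MulOpposite.opLinearEquiv k)
  exact isArtinian_of_tower k inferInstance

lemma ModEndOp.isArtinianObject {T : C} (M : ModEndOp k T) : IsArtinianObject M := by
  have := isArtinianRing_endOp k T
  have : Module.Finite (End T)ᵐᵒᵖ ((ModEndOp.ι k T).obj M) := M.property
  have : IsArtinianObject ((ModEndOp.ι k T).obj M) :=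
    ⟨(ModuleCat.subobjectModule _).strictMono.wellFoundedLT⟩
  exact isArtinianObject_of_map (ModEndOp.ι k T) M

end ModEndOp

section TStructure

variable {D : Type*} [Category* D] [Preadditive D] [HasZeroObject D] [HasShift D ℤ]
  [∀ n : ℤ, (shiftFunctor D n).Additive] [Pretriangulated D]

/-- The preimage of a t-structure under a triangulated equivalence. -/
def tStructurePullback {D' : Type*} [Category* D'] [Preadditive D'] [HasZeroObject D']
    [HasShift D' ℤ] [∀ n : ℤ, (shiftFunctor D' n).Additive] [Pretriangulated D']
    (F : D ⥤ D') [F.CommShift ℤ] [F.IsTriangulated] [F.IsEquivalence]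
    (t : Triangulated.TStructure D') : Triangulated.TStructure D where
  le n := (t.le n).inverseImage F
  ge n := (t.ge n).inverseImage F
  le_shift n a n' h X hX := (t.le n').prop_of_iso ((F.commShiftIso a).symm.app X)
    (t.le_shift n a n' h _ hX)
  ge_shift n a n' h X hX := (t.ge n').prop_of_iso ((F.commShiftIso a).symm.app X)
    (t.ge_shift n a n' h _ hX)
  zero' X Y f hX hY := F.map_injective (by
    rw [F.map_zero]
    exact t.zero' _ hX hY)
  le_zero_le X hX := t.le_zero_le _ hX
  ge_one_le X hX := t.ge_one_le _ hX
  exists_triangle_zero_one A := by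
    obtain ⟨X, Y, hX, hY, f, g, h, hT⟩ := t.exists_triangle_zero_one (F.obj A)
    let e₁ := F.objObjPreimageIso X
    let e₃ := F.objObjPreimageIso Y
    refine ⟨F.objPreimage X, F.objPreimage Y, (t.le 0).prop_of_iso e₁.symm hX,
      (t.ge 1).prop_of_iso e₃.symm hY, F.preimage (e₁.hom ≫ f), F.preimage (g ≫ e₃.inv),
      F.preimage (e₃.hom ≫ h ≫ e₁.inv⟦1⟧' ≫ (F.commShiftIso (1 : ℤ)).inv.app _), ?_⟩
    rw [← F.map_distinguished_iff]
    refine isomorphic_distinguished _ hT _ (Triangle.isoMk _ _ e₁ (Iso.refl _) e₃ ?_ ?_ ?_)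
    · change F.map (F.preimage _) ≫ 𝟙 _ = e₁.hom ≫ f
      rw [F.map_preimage, Category.comp_id]
    · change F.map (F.preimage _) ≫ e₃.hom = 𝟙 _ ≫ g
      simp
    · change (F.map (F.preimage _) ≫ (F.commShiftIso (1 : ℤ)).hom.app _) ≫ e₁.hom⟦1⟧' =
        e₃.hom ≫ h
      simp [← Functor.map_comp]

variable (t : Triangulated.TStructure D)

lemma isGE_iff_of_iso {X Y : D} (e : X ≅ Y) (n : ℤ) : t.IsGE X n ↔ t.IsGE Y n :=
  ⟨fun _ => t.isGE_of_iso e n, fun _ => t.isGE_of_iso e.symm n⟩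

/-- The objects concentrated in degree `n` for a t-structure. -/
def pureIn (n : ℤ) : ObjectProperty D := t.ge n ⊓ t.le n

lemma pureIn_iff (n : ℤ) (X : D) : pureIn t n X ↔ t.IsGE X n ∧ t.IsLE X n := by
  simp [pureIn]

instance (n : ℤ) : (pureIn t n).IsClosedUnderIsomorphisms :=
  inferInstanceAs (t.ge n ⊓ t.le n).IsClosedUnderIsomorphisms

lemma heart_eq_pureIn : t.heart = pureIn t 0 := by
  ext X
  rw [t.mem_heart_iff, pureIn_iff, and_comm]

lemma pureIn_shift_iff (X : D) (n a m : ℤ) (h : a + m = n := by lia) :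
    pureIn t m (X⟦a⟧) ↔ pureIn t n X := by
  rw [pureIn_iff, pureIn_iff, t.isGE_shift_iff X n a m h, t.isLE_shift_iff X n a m h]

lemma sigma_heart (n m : ℤ) (h : n + m = 0) : sigma n t.heart = pureIn t m := by
  ext X
  rw [sigma, heart_eq_pureIn, ObjectProperty.prop_map_iff]
  constructor
  · rintro ⟨Y, hY, ⟨e⟩⟩
    exact (pureIn t m).prop_of_iso e ((pureIn_shift_iff t Y 0 n m).2 hY)
  · intro hX
    exact ⟨X⟦m⟧, (pureIn_shift_iff t X m m 0).2 hX, ⟨(shiftFunctorCompIsoId D m n (by lia)).app X⟩⟩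

section Triangles

variable {X Y Z : D} {f : X ⟶ Y} {g : Y ⟶ Z} {h : Z ⟶ X⟦(1 : ℤ)⟧}
  (hT : Triangle.mk f g h ∈ distTriang D)

include hT

lemma isGE₁ (n m : ℤ) (hY : t.IsGE Y n) (hZ : t.IsGE Z m) (hnm : n ≤ m + 1 := by lia) :
    t.IsGE X n := by
  have := t.isGE_shift Z m (-1) (m + 1)
  exact t.isGE₂ _ (inv_rot_of_distTriang _ hT) n (t.isGE_of_ge (Z⟦(-1 : ℤ)⟧) n (m + 1)) hY

lemma isLE₃ (n m : ℤ) (hX : t.IsLE X m) (hY : t.IsLE Y n) (hmn : m ≤ n + 1 := by lia) :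
    t.IsLE Z n := by
  have := t.isLE_shift X m 1 (m - 1)
  exact t.isLE₂ _ (rot_of_distTriang _ hT) n hY (t.isLE_of_le (X⟦(1 : ℤ)⟧) (m - 1) n)

lemma pureIn₂ (n : ℤ) (hX : pureIn t n X) (hZ : pureIn t n Z) : pureIn t n Y := by
  rw [pureIn_iff] at hX hZ ⊢
  exact ⟨t.isGE₂ _ hT n hX.1 hZ.1, t.isLE₂ _ hT n hX.2 hZ.2⟩

lemma eq_zero_of_comp_mor₁_eq_zero {V : D} (v : V ⟶ X) (n : ℤ) [t.IsLE V n] (hZ : t.IsGE Z n)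
    (hv : v ≫ f = 0) : v = 0 := by
  have hZ' := t.isGE_shift Z n (-1) (n + 1)
  obtain ⟨l, rfl⟩ := Triangle.coyoneda_exact₂ _ (inv_rot_of_distTriang _ hT) v hv
  have hl : l = 0 := t.zero_of_isLE_of_isGE l n (n + 1) (by lia) inferInstance hZ'
  rw [hl]
  exact zero_comp

lemma exists_comp_mor₁_eq {V : D} (v : V ⟶ Y) (n : ℤ) [t.IsLE V n] (hZ : t.IsGE Z (n + 1)) :
    ∃ l : V ⟶ X, l ≫ f = v := by
  obtain ⟨l, hl⟩ := Triangle.coyoneda_exact₂ _ hT v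
    (t.zero_of_isLE_of_isGE _ n (n + 1) (by lia) inferInstance hZ)
  exact ⟨l, hl.symm⟩

lemma isIso_mor₁_of_epi (n : ℤ) (hX : t.IsLE X n) (hZ : t.IsGE Z n) [Epi f] : IsIso f := by
  have hg : g = 0 := by
    rw [← cancel_epi f, comp_zero]
    exact comp_distTriang_mor_zero₁₂ _ hT
  obtain ⟨l, hl⟩ := Triangle.yoneda_exact₃ _ hT (𝟙 Z) (by
    change g ≫ 𝟙 Z = 0
    rw [hg, zero_comp])
  have hX' := t.isLE_shift X n 1 (n - 1)
  have hl₀ : l = 0 := t.zero_of_isLE_of_isGE l (n - 1) n (by lia) hX' hZ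
  refine (Triangle.isZero₃_iff_isIso₁ _ hT).1 ((IsZero.iff_id_eq_zero Z).2 ?_)
  exact hl.trans (hl₀ ▸ comp_zero)

end Triangles

lemma exists_truncation (X : D) (n : ℤ) :
    ∃ (Y Z : D) (f : Y ⟶ X) (g : X ⟶ Z) (h : Z ⟶ Y⟦(1 : ℤ)⟧),
      Triangle.mk f g h ∈ distTriang D ∧ t.IsLE Y n ∧ t.IsGE Z (n + 1) := by
  obtain ⟨Y, Z, hY, hZ, f, g, h, hT⟩ := t.exists_triangle X n _ rfl
  exact ⟨Y, Z, f, g, h, hT, ⟨hY⟩, ⟨hZ⟩⟩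

lemma ge_inf_le_le_extensionProduct (a b c : ℤ) (hab : a ≤ b + 2 := by lia)
    (hbc : b ≤ c + 1 := by lia) :
    t.ge a ⊓ t.le c ≤ (t.ge a ⊓ t.le b).extensionProduct (t.ge (b + 1) ⊓ t.le c) := by
  rintro X ⟨hXa, hXc⟩
  obtain ⟨Y, Z, f, g, h, hT, hY, hZ⟩ := exists_truncation t X b
  exact ⟨Y, Z, f, g, h, hT, ⟨(isGE₁ t hT a (b + 1) ⟨hXa⟩ hZ).ge, hY.le⟩,
    hZ.ge, (isLE₃ t hT c b hY ⟨hXc⟩).le⟩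

lemma ge_inf_le_le_extensionProduct_pureIn (a b c : ℤ) (hab : a + 1 = b := by lia)
    (hbc : b + 1 = c := by lia) :
    t.ge a ⊓ t.le c ≤
      ((pureIn t a).extensionProduct (pureIn t b)).extensionProduct (pureIn t c) := by
  subst hab hbc
  exact (ge_inf_le_le_extensionProduct t a (a + 1) (a + 1 + 1)).trans
    (ObjectProperty.monotone_extensionProduct_left _
      (ge_inf_le_le_extensionProduct t a a (a + 1)))

lemma ge_inf_le_le_of_pureIn_le (P : ObjectProperty D) [P.IsTriangulatedClosed₂]
    [P.IsClosedUnderIsomorphisms] (a : ℤ) (n : ℕ)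
    (hP : ∀ i, a ≤ i → i ≤ a + n → pureIn t i ≤ P) : t.ge a ⊓ t.le (a + n) ≤ P := by
  induction n with
  | zero => simpa [pureIn] using hP a le_rfl
  | succ n ih =>
    rw [Nat.cast_succ, ← add_assoc] at hP ⊢
    exact (ge_inf_le_le_extensionProduct t a (a + n) (a + n + 1)).trans
      (ObjectProperty.extensionProduct_le_of_isTriangulatedClosed₂
        (ih fun i hi hi' => hP i hi (by lia)) (hP _ (by lia) le_rfl))

end TStructure

section Tilt

variable {D : Type*} [Category* D] [Preadditive D] [HasZeroObject D] [HasShift D ℤ]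
  [∀ n : ℤ, (shiftFunctor D n).Additive] [Pretriangulated D]

/-- The t-structure `tB` is obtained from `tA` by tilting in amplitude `[0, n]`: an object of the
heart of `tA` only has cohomology in degrees `0, …, n` with respect to `tB`. The condition is
imposed on the aisles because for unbounded `tA` the heart does not determine them. -/
structure IsTilt (tA tB : Triangulated.TStructure D) (n : ℤ) : Prop where
  ge_zero_le : tA.ge 0 ≤ tB.ge 0
  le_zero_le : tA.le 0 ≤ tB.le n

namespace IsTilt

variable {tA tB : Triangulated.TStructure D} {n : ℤ}

lemma of_pureIn_zero_le (hge : pureIn tA 0 ≤ tB.ge 0) (hle : pureIn tA 0 ≤ tB.le n)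
    (hbdd : ∀ X, tA.bounded X) : IsTilt tA tB n := by
  have : (tB.ge 0).IsTriangulatedClosed₂ := .mk' fun T hT hX hZ =>
    (tB.isGE₂ T hT 0 ⟨hX⟩ ⟨hZ⟩).ge
  have : (tB.le n).IsTriangulatedClosed₂ := .mk' fun T hT hX hZ =>
    (tB.isLE₂ T hT n ⟨hX⟩ ⟨hZ⟩).le
  constructor
  · intro X hX
    obtain ⟨b, hb⟩ := (hbdd X).2
    refine ge_inf_le_le_of_pureIn_le tA (tB.ge 0) 0 b.toNat (fun i hi _ Y hY => ?_) X
      ⟨hX, (tA.isLE_of_le X b (0 + b.toNat)).le⟩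
    have : tB.IsGE (Y⟦i⟧) 0 := ⟨hge _ ((pureIn_shift_iff tA Y i i 0).2 hY)⟩
    have := tB.isGE_of_shift Y i i 0
    exact (tB.isGE_of_ge Y 0 i).ge
  · intro X hX
    obtain ⟨a, ha⟩ := (hbdd X).1
    refine ge_inf_le_le_of_pureIn_le tA (tB.le n) (-(-a).toNat) (-a).toNat
      (fun i _ hi Y hY => ?_) X ⟨(tA.isGE_of_ge X (-(-a).toNat) a).ge, by simpa using hX⟩
    have : tB.IsLE (Y⟦i⟧) n := ⟨hle _ ((pureIn_shift_iff tA Y i i 0).2 hY)⟩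
    have := tB.isLE_of_shift Y (i + n) i n
    exact (tB.isLE_of_le Y (i + n) n).le

section

variable (h : IsTilt tA tB n)

include h

lemma isGE (X : D) (a : ℤ) [tA.IsGE X a] : tB.IsGE X a := by
  have := tA.isGE_shift X a a 0
  have : tB.IsGE (X⟦a⟧) 0 := ⟨h.ge_zero_le _ this.ge⟩
  exact tB.isGE_of_shift X a a 0

lemma isLE (X : D) (a b : ℤ) (hab : a + n = b := by lia) [tA.IsLE X a] : tB.IsLE X b := by
  have := tA.isLE_shift X a a 0
  have : tB.IsLE (X⟦a⟧) n := ⟨h.le_zero_le _ this.le⟩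
  exact tB.isLE_of_shift X b a n

lemma isLE_symm (X : D) (a : ℤ) [tB.IsLE X a] : tA.IsLE X a := by
  rw [tA.isLE_iff_orthogonal a (a + 1) rfl]
  intro Y f _
  have := h.isGE Y (a + 1)
  exact tB.zero f a (a + 1)

lemma isGE_symm (X : D) (a b : ℤ) (hab : b + n = a := by lia) [tB.IsGE X a] : tA.IsGE X b := by
  rw [tA.isGE_iff_orthogonal (b - 1) b (by lia)]
  intro Y f _
  have := h.isLE Y (b - 1) (a - 1)
  exact tB.zero f (a - 1) a

end

lemma heart_le_extensionProduct (h : IsTilt tA tB 2) :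
    tA.heart ≤ (tB.heart.extensionProduct (sigma (-1) tB.heart)).extensionProduct
      (sigma (-2) tB.heart) := by
  rw [sigma_heart tB (-1) 1 (by lia), sigma_heart tB (-2) 2 (by lia), heart_eq_pureIn tB]
  rintro X ⟨hXl, hXg⟩
  exact ge_inf_le_le_extensionProduct_pureIn tB 0 1 2 rfl rfl X
    ⟨h.ge_zero_le X hXg, h.le_zero_le X hXl⟩

lemma heart_le_extensionProduct_symm (h : IsTilt tA tB 2) :
    tB.heart ≤ ((sigma 2 tA.heart).extensionProduct (sigma 1 tA.heart)).extensionProduct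
      tA.heart := by
  rw [sigma_heart tA 2 (-2) (by lia), sigma_heart tA 1 (-1) (by lia), heart_eq_pureIn tA]
  intro X hX
  obtain ⟨_, _⟩ := (tB.mem_heart_iff X).1 hX
  exact ge_inf_le_le_extensionProduct_pureIn tA (-2) (-1) 0 rfl rfl X
    ⟨(h.isGE_symm X 0 (-2)).ge, (h.isLE_symm X 0).le⟩

end IsTilt

end Tilt

section EssImage

variable {C : Type*} [Category* C]
  {D : Type*} [Category* D] [Preadditive D] [HasZeroObject D] [HasShift D ℤ]
  [∀ n : ℤ, (shiftFunctor D n).Additive] [Pretriangulated D]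
  {t : Triangulated.TStructure D} {n : ℤ} {ι : C ⥤ D} (hι : ι.essImage = pureIn t n)

include hι

lemma pureIn_obj_of_essImage (x : C) : pureIn t n (ι.obj x) := hι ▸ ι.obj_mem_essImage x

lemma isGE_obj_of_essImage (x : C) : t.IsGE (ι.obj x) n :=
  ((pureIn_iff ..).1 (pureIn_obj_of_essImage hι x)).1

lemma isLE_obj_of_essImage (x : C) : t.IsLE (ι.obj x) n :=
  ((pureIn_iff ..).1 (pureIn_obj_of_essImage hι x)).2

lemma exists_iso_of_isGE_of_isLE (X : D) (hX : t.IsGE X n) (hX' : t.IsLE X n) :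
    ∃ x : C, Nonempty (ι.obj x ≅ X) := by
  have h : pureIn t n X := (pureIn_iff ..).2 ⟨hX, hX'⟩
  rwa [← hι] at h

lemma exists_truncation_of_isGE (X : D) (hX : t.IsGE X n) :
    ∃ (x : C) (Z : D) (f : ι.obj x ⟶ X) (g : X ⟶ Z) (h : Z ⟶ (ι.obj x)⟦(1 : ℤ)⟧),
      Triangle.mk f g h ∈ distTriang D ∧ t.IsGE Z (n + 1) := by
  obtain ⟨Y, Z, f, g, h, hT, hY, hZ⟩ := exists_truncation t X n
  obtain ⟨x, ⟨e⟩⟩ := exists_iso_of_isGE_of_isLE hι Y (isGE₁ t hT n (n + 1) hX hZ) hY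
  refine ⟨x, Z, e.hom ≫ f, g, h ≫ e.inv⟦1⟧', ?_, hZ⟩
  exact isomorphic_distinguished _ hT _ (Triangle.isoMk _ _ e (Iso.refl _) (Iso.refl _)
    (show (e.hom ≫ f) ≫ 𝟙 _ = e.hom ≫ f by simp) (show g ≫ 𝟙 _ = 𝟙 _ ≫ g by simp)
    (show (h ≫ e.inv⟦1⟧') ≫ e.hom⟦1⟧' = 𝟙 _ ≫ h by simp [← Functor.map_comp]))

lemma mono_of_distinguished [ι.Faithful] {x y : C} {φ : x ⟶ y} {Z : D} {g : ι.obj y ⟶ Z}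
    {h : Z ⟶ (ι.obj x)⟦(1 : ℤ)⟧} (hT : Triangle.mk (ι.map φ) g h ∈ distTriang D)
    (hZ : t.IsGE Z n) : Mono φ where
  right_cancellation {z} u v huv := ι.map_injective <| sub_eq_zero.1 <| by
    have := isLE_obj_of_essImage hι z
    refine eq_zero_of_comp_mor₁_eq_zero t hT _ n hZ ?_
    rw [Preadditive.sub_comp, ← ι.map_comp, ← ι.map_comp, huv, sub_self]

end EssImage

section AbelianEssImage

variable {C : Type*} [Category* C] [Abelian C]
  {D : Type*} [Category* D] [Preadditive D] [HasZeroObject D] [HasShift D ℤ]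
  [∀ n : ℤ, (shiftFunctor D n).Additive] [Pretriangulated D]
  {t : Triangulated.TStructure D} {n : ℤ} {ι : C ⥤ D} [ι.Full] [ι.Faithful] [ι.Additive]
  (hι : ι.essImage = pureIn t n)

include hι in
lemma mono_exact_of_distinguished {m x y : C} {W S : D}
    {a : ι.obj m ⟶ W} {b : W ⟶ S} {c : S ⟶ (ι.obj m)⟦(1 : ℤ)⟧}
    (hm : Triangle.mk a b c ∈ distTriang D) (hS : t.IsGE S (n + 1))
    {f : W ⟶ ι.obj x} {φ : x ⟶ y} {h : ι.obj y ⟶ W⟦(1 : ℤ)⟧}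
    (hW : Triangle.mk f (ι.map φ) h ∈ distTriang D)
    {j : m ⟶ x} (hj : ι.map j = a ≫ f) (hjφ : j ≫ φ = 0) :
    Mono j ∧ (ShortComplex.mk j φ hjφ).Exact := by
  have hy := isGE_obj_of_essImage hι y
  have hS' := t.isGE_of_ge S n (n + 1)
  have hmono : Mono j := ⟨fun {z} u v huv => ι.map_injective <| sub_eq_zero.1 <| by
    have := isLE_obj_of_essImage hι z
    refine eq_zero_of_comp_mor₁_eq_zero t hm _ n hS'
      (eq_zero_of_comp_mor₁_eq_zero t hW _ n hy ?_)
    rw [Category.assoc, ← hj, Preadditive.sub_comp, ← ι.map_comp, ← ι.map_comp, huv, sub_self]⟩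
  refine ⟨hmono, ShortComplex.exact_of_f_is_kernel _ (KernelFork.IsLimit.ofι' _ _ ?_)⟩
  intro z (k : z ⟶ x) (hk : k ≫ φ = 0)
  suffices h : ∃ l : z ⟶ m, l ≫ j = k from ⟨h.choose, h.choose_spec⟩
  have hz := isLE_obj_of_essImage hι z
  have hk₀ : ι.map k ≫ ι.map φ = 0 := by rw [← ι.map_comp, hk, ι.map_zero]
  obtain ⟨k', hk'⟩ := Triangle.coyoneda_exact₂ _ hW (ι.map k) hk₀
  obtain ⟨l, hl⟩ := exists_comp_mor₁_eq t hm k' n hS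
  refine ⟨ι.preimage l, ι.map_injective ?_⟩
  rw [ι.map_comp, ι.map_preimage, hj, reassoc_of% hl]
  exact hk'.symm

end AbelianEssImage

section Filtration

variable {C : Type*} [Category* C] [Abelian C]
  {D : Type*} [Category* D] [Preadditive D] [HasZeroObject D] [HasShift D ℤ]
  [∀ n : ℤ, (shiftFunctor D n).Additive] [Pretriangulated D]
  {tA tB : Triangulated.TStructure D} (htilt : IsTilt tA tB 2)
  {ι : C ⥤ D} [ι.Full] [ι.Additive] (hι : ι.essImage = pureIn tA 0)

include htilt hι

lemma exists_subobject_gen (x : C) [IsNoetherianObject x] :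
    ∃ p : Subobject x, extClosure (gen ((pureIn tB 0).inverseImage ι)) (p : C) ∧
      tB.IsGE (ι.obj (cokernel p.arrow)) 1 := by
  obtain ⟨p, hp, hmax⟩ := exists_subobject_extClosure_gen ((pureIn tB 0).inverseImage ι) x
  refine ⟨p, hp, ?_⟩
  have hy := isGE_obj_of_essImage hι (cokernel p.arrow)
  obtain ⟨b, r, f, g, h, hT, hb, hr⟩ := exists_truncation tB (ι.obj (cokernel p.arrow)) 0
  have hr₁ : tB.IsGE r 1 := hr
  have hbA : tA.IsGE b 0 := isGE₁ tA hT 0 (-1) hy (htilt.isGE_symm r 1 (-1))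
  obtain ⟨b₀, ⟨e⟩⟩ := exists_iso_of_isGE_of_isLE hι b hbA (htilt.isLE_symm b 0)
  have hb₀ : pureIn tB 0 (ι.obj b₀) := (pureIn tB 0).prop_of_iso e.symm
    ((pureIn_iff ..).2 ⟨isGE₁ tB hT 0 1 (htilt.isGE _ 0) hr, hb⟩)
  have hf : f = 0 := by
    rw [← cancel_epi e.hom, comp_zero, ← ι.map_preimage (e.hom ≫ f), hmax hb₀ (ι.preimage _),
      ι.map_zero]
  have hbz : IsZero b := (IsZero.iff_id_eq_zero b).2 <|
    eq_zero_of_comp_mor₁_eq_zero tB hT (𝟙 b) 0 (tB.isGE_of_ge r 0 1) (by rw [hf, comp_zero])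
  exact tB.isGE₂ _ hT 1 (tB.isGE_of_isZero hbz 1) hr

variable [ι.Faithful]

lemma exists_mono_of_distinguished {x : C} {r w : D} {f : r ⟶ ι.obj x} {g : ι.obj x ⟶ w}
    {h : w ⟶ r⟦(1 : ℤ)⟧} (hT : Triangle.mk f g h ∈ distTriang D) (hr : tB.IsLE r 1)
    (hw : tB.IsGE w 2) :
    ∃ (m : C) (j : m ⟶ x) (s : D) (a : ι.obj m ⟶ r) (b : r ⟶ s)
      (c : s ⟶ (ι.obj m)⟦(1 : ℤ)⟧),
      Mono j ∧ sub ((pureIn tB 2).inverseImage ι) (cokernel j) ∧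
        Triangle.mk a b c ∈ distTriang D ∧ tA.IsGE s 1 := by
  have hx := isGE_obj_of_essImage hι x
  have hx' := isLE_obj_of_essImage hι x
  have hwA : tA.IsGE w 0 := htilt.isGE_symm w 2 0
  obtain ⟨y, ⟨e⟩⟩ := exists_iso_of_isGE_of_isLE hι w hwA
    (isLE₃ tA hT 0 1 (htilt.isLE_symm r 1) hx')
  have hy : pureIn tB 2 (ι.obj y) := (pureIn tB 2).prop_of_iso e.symm
    ((pureIn_iff ..).2 ⟨hw, isLE₃ tB hT 2 1 hr (htilt.isLE _ 0 2)⟩)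
  let φ : x ⟶ y := ι.preimage (g ≫ e.inv)
  have hφ : ι.map φ = g ≫ e.inv := ι.map_preimage _
  have hT' : Triangle.mk f (ι.map φ) (e.hom ≫ h) ∈ distTriang D :=
    isomorphic_distinguished _ hT _ (Triangle.isoMk _ _ (Iso.refl _) (Iso.refl _) e
      (show f ≫ 𝟙 _ = 𝟙 _ ≫ f by simp) (show ι.map φ ≫ e.hom = 𝟙 _ ≫ g by simp [hφ])
      (show (e.hom ≫ h) ≫ (𝟙 _)⟦(1 : ℤ)⟧' = e.hom ≫ h by simp))
  obtain ⟨m, s, a, b, c, hm, hs⟩ := exists_truncation_of_isGE hι r (isGE₁ tA hT 0 0 hx hwA)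
  have hj : ι.map (ι.preimage (a ≫ f)) = a ≫ f := ι.map_preimage _
  have hfφ : f ≫ ι.map φ = 0 := comp_distTriang_mor_zero₁₂ _ hT'
  have hjφ : ι.preimage (a ≫ f) ≫ φ = 0 := ι.map_injective (by
    rw [ι.map_comp, ι.map_zero, hj, Category.assoc, hfφ, comp_zero])
  obtain ⟨hmono, hex⟩ := mono_exact_of_distinguished hι hm hs hT' hj hjφ
  exact ⟨m, _, s, a, b, c, hmono, ⟨y, hy, _, hex.mono_cokernelDesc⟩, hm, hs⟩

variable [IsTriangulated D] {B : Type*} [Category* B] {ι₁ : B ⥤ D} [ι₁.Full] [ι₁.Faithful]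
  (h₁ : ι₁.essImage = pureIn tB 1)

include h₁

lemma exists_mono_descent {x : C} {b : B} {w : D} {f : ι₁.obj b ⟶ ι.obj x} {g : ι.obj x ⟶ w}
    {h : w ⟶ (ι₁.obj b)⟦(1 : ℤ)⟧} (hT : Triangle.mk f g h ∈ distTriang D) (hw : tB.IsGE w 2) :
    ∃ (m : C) (j : m ⟶ x) (b' : B) (φ : b' ⟶ b) (w' : D) (f' : ι₁.obj b' ⟶ ι.obj m)
      (g' : ι.obj m ⟶ w') (h' : w' ⟶ (ι₁.obj b')⟦(1 : ℤ)⟧),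
      Mono j ∧ sub ((pureIn tB 2).inverseImage ι) (cokernel j) ∧
        Triangle.mk f' g' h' ∈ distTriang D ∧ tB.IsGE w' 2 ∧
          Mono φ ∧ (IsIso φ → pureIn tB 1 (ι.obj m)) := by
  have hb := isGE_obj_of_essImage h₁ b
  obtain ⟨m, j, s, a, u, v, hj, hsub, hm, hs⟩ :=
    exists_mono_of_distinguished htilt hι hT (isLE_obj_of_essImage h₁ b) hw
  have hsB : tB.IsGE s 1 := htilt.isGE s 1
  obtain ⟨b', w', f', g', h', hT₁, hw'⟩ :=
    exists_truncation_of_isGE h₁ (ι.obj m) (isGE₁ tB hm 1 1 hb hsB)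
  have hφ : f' ≫ a = ι₁.map (ι₁.preimage (f' ≫ a)) := (ι₁.map_preimage _).symm
  obtain ⟨z, p, q, hT₂⟩ := distinguished_cocone_triangle (ι₁.map (ι₁.preimage (f' ≫ a)))
  have o := Triangulated.someOctahedron hφ hT₁ hm hT₂
  have hz : tB.IsGE z 1 := tB.isGE₂ _ o.mem 1 (tB.isGE_of_ge w' 1 (1 + 1)) hsB
  refine ⟨m, j, b', _, w', f', g', h', hj, hsub, hT₁, hw',
    mono_of_distinguished h₁ hT₂ hz, fun _ => ?_⟩
  have : IsIso (f' ≫ a) := hφ ▸ inferInstance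
  have : Epi a := epi_of_epi f' a
  have : IsIso a :=
    isIso_mor₁_of_epi tA hm 0 (isLE_obj_of_essImage hι m) (tA.isGE_of_ge s 0 1)
  exact (pureIn tB 1).prop_of_iso (asIso a).symm (pureIn_obj_of_essImage h₁ b)

lemma exists_mono_pureIn_one (hB : ∀ b : B, IsArtinianObject b) {x : C} {b : B} {w : D}
    {f : ι₁.obj b ⟶ ι.obj x} {g : ι.obj x ⟶ w} {h : w ⟶ (ι₁.obj b)⟦(1 : ℤ)⟧}
    (hT : Triangle.mk f g h ∈ distTriang D) (hw : tB.IsGE w 2) :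
    ∃ (m : C) (j : m ⟶ x), Mono j ∧ pureIn tB 1 (ι.obj m) ∧
      extClosure (sub ((pureIn tB 2).inverseImage ι)) (cokernel j) := by
  induction b using (wellFounded_mono_not_isIso hB).induction generalizing x w with
  | _ b ih =>
    obtain ⟨m, j, b', φ, w', f', g', h', hj, hsub, hT', hw', hφ, hφm⟩ :=
      exists_mono_descent htilt hι h₁ hT hw
    have hcok := le_extClosure _ _ hsub
    by_cases hiso : IsIso φ
    · exact ⟨m, j, hj, hφm hiso, hcok⟩
    · obtain ⟨n, i, hi, hn, hcok'⟩ := ih b' ⟨φ, hφ, hiso⟩ hT' hw'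
      exact ⟨n, i ≫ j, mono_comp i j, hn, prop_cokernel_comp _ i j hcok' hcok⟩

lemma exists_filtration (hB : ∀ b : B, IsArtinianObject b) (x : C) [IsNoetherianObject x] :
    ∃ (p q : Subobject x) (h : p ≤ q),
      extClosure (gen ((pureIn tB 0).inverseImage ι)) (subquotient (bot_le : ⊥ ≤ p)) ∧
      (pureIn tB 1).inverseImage ι (subquotient h) ∧
      extClosure (sub ((pureIn tB 2).inverseImage ι)) (subquotient (le_top : q ≤ ⊤)) := by
  obtain ⟨p, hp, hy⟩ := exists_subobject_gen htilt hι x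
  obtain ⟨b, w, f, g, h, hT, hw⟩ := exists_truncation_of_isGE h₁ _ hy
  obtain ⟨m, j, hj, hm, hcok⟩ := exists_mono_pureIn_one htilt hι h₁ hB hT hw
  obtain ⟨q, hpq, ⟨e₁⟩, ⟨e₂⟩⟩ := exists_subobject_of_mono_cokernel p j
  obtain ⟨e₀⟩ := nonempty_subquotient_bot_iso p
  exact ⟨p, q, hpq, ObjectProperty.prop_of_iso _ e₀.symm hp,
    ((pureIn tB 1).inverseImage ι).prop_of_iso e₁.symm hm,
    ObjectProperty.prop_of_iso _ e₂.symm hcok⟩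

end Filtration

section BoundedDerivedCategory

variable {C : Type u} [Category.{v} C] [Abelian C] [HasDerivedCategory.{w} C]

/-- The standard t-structure on the bounded derived category. -/
abbrev Db.t (C : Type u) [Category.{v} C] [Abelian C] [HasDerivedCategory.{w} C] :
    Triangulated.TStructure (Db C) :=
  (DerivedCategory.TStructure.t (C := C)).onBounded

lemma Db.isGE_iff (X : Db C) (n : ℤ) :
    (Db.t C).IsGE X n ↔ ∀ i < n, IsZero ((Db.homology C i).obj X) := by
  rw [ObjectProperty.tStructure_isGE_iff]
  exact DerivedCategory.isGE_iff X.obj n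

lemma Db.isLE_iff (X : Db C) (n : ℤ) :
    (Db.t C).IsLE X n ↔ ∀ i > n, IsZero ((Db.homology C i).obj X) := by
  rw [ObjectProperty.tStructure_isLE_iff]
  exact DerivedCategory.isLE_iff X.obj n

lemma Db.pureIn_iff (X : Db C) (n : ℤ) :
    pureIn (Db.t C) n X ↔ ∀ i, i ≠ n → IsZero ((Db.homology C i).obj X) := by
  rw [JMS.pureIn_iff, Db.isGE_iff, Db.isLE_iff]
  exact ⟨fun h i hi => (lt_or_gt_of_ne hi).elim (h.1 i) (h.2 i),
    fun h => ⟨fun i hi => h i hi.ne, fun i hi => h i hi.ne'⟩⟩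

lemma Db.bounded (X : Db C) : (Db.t C).bounded X := by
  obtain ⟨⟨a, ha⟩, ⟨b, hb⟩⟩ := X.property
  exact ⟨⟨a, (ObjectProperty.tStructure_isGE_iff ..).2 ha⟩,
    ⟨b, (ObjectProperty.tStructure_isLE_iff ..).2 hb⟩⟩

instance : (Db.single C).Full where
  map_surjective f := by
    obtain ⟨g, hg⟩ := (DerivedCategory.singleFunctor C 0).map_surjective f.hom
    exact ⟨g, (Db.ι C).map_injective hg⟩

instance : (Db.single C).Faithful where
  map_injective h :=
    (DerivedCategory.singleFunctor C 0).map_injective ((Db.ι C).congr_map h)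

instance : (Db.single C).Additive where
  map_add := (Db.ι C).map_injective ((DerivedCategory.singleFunctor C 0).map_add)

lemma Db.essImage_single : (Db.single C).essImage = pureIn (Db.t C) 0 := by
  ext X
  rw [JMS.pureIn_iff, ObjectProperty.tStructure_isGE_iff, ObjectProperty.tStructure_isLE_iff]
  constructor
  · rintro ⟨Y, ⟨e⟩⟩
    let e' : (DerivedCategory.singleFunctor C 0).obj Y ≅ X.obj := (Db.ι C).mapIso e
    exact ⟨DerivedCategory.TStructure.t.isGE_of_iso e' 0,
      DerivedCategory.TStructure.t.isLE_of_iso e' 0⟩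
  · rintro ⟨_, _⟩
    obtain ⟨Y, ⟨e⟩⟩ := DerivedCategory.exists_iso_singleFunctor_obj_of_isGE_of_isLE X.obj 0
    exact ⟨Y, ⟨(Db.ι C).preimageIso e.symm⟩⟩

lemma Db.heart_eq : Db.heart C = (Db.t C).heart := by
  rw [Db.heart, Db.essImage_single, heart_eq_pureIn]

lemma Db.exists_distinguished {S : ShortComplex C} (hS : S.ShortExact) :
    ∃ h : (Db.single C).obj S.X₃ ⟶ ((Db.single C).obj S.X₁)⟦(1 : ℤ)⟧,
      Triangle.mk ((Db.single C).map S.f) ((Db.single C).map S.g) h ∈ distTriang (Db C) := by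
  let δ : (Db.ι C).obj ((Db.single C).obj S.X₃) ⟶
    ((Db.ι C).obj ((Db.single C).obj S.X₁))⟦(1 : ℤ)⟧ := hS.singleδ
  refine ⟨(Db.ι C).preimage (δ ≫ ((Db.ι C).commShiftIso (1 : ℤ)).inv.app _), ?_⟩
  rw [← (Db.ι C).map_distinguished_iff]
  refine isomorphic_distinguished _ hS.singleTriangle_distinguished _
    (Triangle.isoMk _ _ (Iso.refl _) (Iso.refl _) (Iso.refl _) ?_ ?_ ?_)
  · exact (Category.comp_id _).trans (Category.id_comp _).symm
  · exact (Category.comp_id _).trans (Category.id_comp _).symm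
  · change ((Db.ι C).map ((Db.ι C).preimage _) ≫ ((Db.ι C).commShiftIso (1 : ℤ)).hom.app _) ≫
      (𝟙 _)⟦1⟧' = 𝟙 _ ≫ δ
    rw [Functor.map_preimage, Category.assoc, Category.assoc, Iso.inv_hom_id_app_assoc,
      CategoryTheory.Functor.map_id, Category.id_comp]
    exact Category.comp_id _

end BoundedDerivedCategory

section Classes

variable {C : Type u} [Category.{v} C] [Abelian C] [HasDerivedCategory.{w} C]
  {D : Type u'} [Category.{v} D] [Abelian D] [HasDerivedCategory.{w'} D]

lemma concentrated_iff (F : Db C ⥤ Db D) (i : ℤ) (x : C) :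
    concentrated F i x ↔ pureIn (Db.t D) i (F.obj ((Db.single C).obj x)) :=
  (Db.pureIn_iff _ i).symm

variable (F : Db C ⥤ Db D) [F.CommShift ℤ] [F.IsTriangulated]

instance (i : ℤ) : (concentrated F i).IsClosedUnderIsomorphisms where
  of_iso e hx := by
    rw [concentrated_iff] at hx ⊢
    exact (pureIn _ i).prop_of_iso (F.mapIso ((Db.single C).mapIso e)) hx

instance (i : ℤ) : (concentrated F i).IsClosedUnderExtensions where
  prop_X₂_of_shortExact hS h₁ h₃ := by
    obtain ⟨h, hT⟩ := Db.exists_distinguished hS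
    rw [concentrated_iff] at h₁ h₃ ⊢
    exact pureIn₂ _ (F.map_distinguished _ hT) i h₁ h₃

lemma concentrated_le_leftOrthogonal [F.Faithful] {i j : ℤ} (hij : i < j) :
    concentrated F i ≤ (concentrated F j).leftOrthogonal := by
  intro x hx y f hy
  rw [concentrated_iff, pureIn_iff] at hx hy
  obtain ⟨-, _⟩ := hx
  obtain ⟨_, -⟩ := hy
  apply (Db.single C).map_injective
  apply F.map_injective
  rw [(Db.t D).zero (F.map ((Db.single C).map f)) i j hij, (Db.single C).map_zero, F.map_zero]

lemma isClosedUnderExtensions_filtClass (i : Fin 3) :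
    (filtClass F i).IsClosedUnderExtensions := by
  fin_cases i
  · exact inferInstanceAs (extClosure (gen (concentrated F 0))).IsClosedUnderExtensions
  · exact inferInstanceAs (concentrated F 1).IsClosedUnderExtensions
  · exact inferInstanceAs (extClosure (sub (concentrated F 2))).IsClosedUnderExtensions

lemma filtClass_le_leftOrthogonal [F.Faithful] {i j : Fin 3} (hij : i < j) :
    filtClass F i ≤ (filtClass F j).leftOrthogonal := by
  have h₀₁ : filtClass F 0 ≤ (filtClass F 1).leftOrthogonal :=
    extClosure_gen_le_leftOrthogonal (concentrated_le_leftOrthogonal F (by decide))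
  have h₁₂ : filtClass F 1 ≤ (filtClass F 2).leftOrthogonal :=
    le_leftOrthogonal_extClosure_sub (concentrated_le_leftOrthogonal F (by decide))
  have h₀₂ : filtClass F 0 ≤ (filtClass F 2).leftOrthogonal :=
    extClosure_gen_le_leftOrthogonal
      (le_leftOrthogonal_extClosure_sub (concentrated_le_leftOrthogonal F (by decide)))
  fin_cases i <;> fin_cases j
  all_goals first
    | exact absurd hij (by decide)
    | exact h₀₁
    | exact h₀₂
    | exact h₁₂

end Classes

section Equivalence

section Pullback

variable {C D E : Type*} [Category* C]
  [Category* D] [Preadditive D] [HasZeroObject D] [HasShift D ℤ]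
  [∀ n : ℤ, (shiftFunctor D n).Additive] [Pretriangulated D]
  [Category* E] [Preadditive E] [HasZeroObject E] [HasShift E ℤ]
  [∀ n : ℤ, (shiftFunctor E n).Additive] [Pretriangulated E]

lemma essImage_comp_shiftFunctor {t : Triangulated.TStructure D} {ι : C ⥤ D} {n : ℤ}
    (hι : ι.essImage = pureIn t n) (a m : ℤ) (h : a + m = n := by lia) :
    (ι ⋙ shiftFunctor D a).essImage = pureIn t m := by
  ext X
  rw [← pureIn_shift_iff t X m (-a) n, ← hι]
  constructor
  · rintro ⟨x, ⟨e⟩⟩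
    exact ⟨x, ⟨(shiftShiftNeg (ι.obj x) a).symm ≪≫ (shiftFunctor D (-a)).mapIso e⟩⟩
  · rintro ⟨x, ⟨e⟩⟩
    exact ⟨x, ⟨(shiftFunctor D a).mapIso e ≪≫ shiftNegShift X a⟩⟩

lemma essImage_comp_inv {t : Triangulated.TStructure E} {ι : C ⥤ E} {n : ℤ}
    (hι : ι.essImage = pureIn t n) (F : D ⥤ E) [F.CommShift ℤ] [F.IsTriangulated]
    [F.IsEquivalence] :
    (ι ⋙ F.inv).essImage = pureIn (tStructurePullback F t) n := by
  ext X
  change _ ↔ pureIn t n (F.obj X)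
  rw [← hι]
  constructor
  · rintro ⟨x, ⟨e⟩⟩
    exact ⟨x, ⟨(F.asEquivalence.counitIso.app (ι.obj x)).symm ≪≫ F.mapIso e⟩⟩
  · rintro ⟨x, ⟨e⟩⟩
    exact ⟨x, ⟨F.inv.mapIso e ≪≫ (F.asEquivalence.unitIso.app X).symm⟩⟩

end Pullback

variable {C : Type u} [Category.{v} C] [Abelian C] [HasDerivedCategory.{w} C]
  {D : Type u'} [Category.{v} D] [Abelian D] [HasDerivedCategory.{w'} D]
  (F : Db C ⥤ Db D) [F.CommShift ℤ] [F.IsTriangulated] [F.IsEquivalence]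

lemma pullbackHeart_eq : pullbackHeart F = (tStructurePullback F (Db.t D)).heart := by
  rw [pullbackHeart, Db.heart_eq, heart_eq_pureIn, heart_eq_pureIn]
  rfl

lemma concentrated_eq (i : ℤ) : concentrated F i =
    (pureIn (tStructurePullback F (Db.t D)) i).inverseImage (Db.single C) := by
  ext x
  exact concentrated_iff F i x

lemma isTilt_of_isZero_homology {n : ℤ}
    (hneg : ∀ (x : C), ∀ i < 0, IsZero ((Db.homology D i).obj (F.obj ((Db.single C).obj x))))
    (hpos : ∀ (x : C), ∀ i > n, IsZero ((Db.homology D i).obj (F.obj ((Db.single C).obj x)))) :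
    IsTilt (Db.t C) (tStructurePullback F (Db.t D)) n := by
  refine IsTilt.of_pureIn_zero_le ?_ ?_ Db.bounded
  all_goals
    rw [← Db.essImage_single]
    rintro X ⟨x, ⟨e⟩⟩
  · have := (Db.isGE_iff _ 0).2 (hneg x)
    exact ((Db.t D).isGE_of_iso (F.mapIso e) 0).ge
  · have := (Db.isLE_iff _ n).2 (hpos x)
    exact ((Db.t D).isLE_of_iso (F.mapIso e) n).le

lemma existsUnique_filtration
    (htilt : IsTilt (Db.t C) (tStructurePullback F (Db.t D)) 2)
    (hD : ∀ y : D, IsArtinianObject y) (x : C) [IsNoetherianObject x] :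
    ∃! p : Subobject x × Subobject x, ∃ h : p.1 ≤ p.2,
      filtClass F 0 (subquotient (bot_le : ⊥ ≤ p.1)) ∧
      filtClass F 1 (subquotient h) ∧
      filtClass F 2 (subquotient (le_top : p.2 ≤ ⊤)) := by
  have hι₁ := essImage_comp_shiftFunctor (essImage_comp_inv Db.essImage_single F) (-1) 1
  obtain ⟨p, q, h, h₀⟩ := exists_filtration htilt Db.essImage_single hι₁ hD x
  simp only [← concentrated_eq] at h₀
  refine ⟨⟨p, q⟩, ⟨h, h₀⟩, ?_⟩
  rintro ⟨p', q'⟩ ⟨h', h₀'⟩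
  have h₀₁ := filtClass_le_leftOrthogonal F (i := 0) (j := 1) (by decide)
  have h₀₂ := filtClass_le_leftOrthogonal F (i := 0) (j := 2) (by decide)
  have h₁₂ := filtClass_le_leftOrthogonal F (i := 1) (j := 2) (by decide)
  obtain ⟨hp, hq⟩ :=
    filtration_le_of_orthogonal h₀₁ h₀₂ h₁₂ h h' h₀.1 h₀.2.1 h₀'.2.1 h₀'.2.2
  obtain ⟨hp', hq'⟩ :=
    filtration_le_of_orthogonal h₀₁ h₀₂ h₁₂ h' h h₀'.1 h₀'.2.1 h₀.2.1 h₀.2.2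
  exact Prod.ext (hp'.antisymm hp) (hq'.antisymm hq)

end Equivalence

section LeftExactness

lemma isGE_rightDerivedFunctorPlus_obj {C D : Type*} [Category* C] [Category* D]
    [Abelian C] [Abelian D] [HasDerivedCategory C] [HasDerivedCategory D]
    (G : C ⥤ D) [G.Additive] [EnoughInjectives C]
    (X : DerivedCategory.Plus C) (n : ℤ) [X.IsGE n] :
    (G.rightDerivedFunctorPlus.obj X).IsGE n := by
  obtain ⟨L, hL, ⟨e⟩⟩ := DerivedCategory.Plus.exists_injective_nonempty_iso X n
  let I := (InjectiveObject.ι C).mapCochainComplexPlus.obj L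
  have : IsIso (G.rightDerivedFunctorPlusUnit.app ((HomotopyCategory.Plus.quotient C).obj I)) := by
    dsimp only [I]
    infer_instance
  let e' := asIso (G.rightDerivedFunctorPlusUnit.app ((HomotopyCategory.Plus.quotient C).obj I)) ≪≫
    G.rightDerivedFunctorPlus.mapIso e
  have hI : I.obj.IsStrictlyGE n := inferInstanceAs (CochainComplex.IsStrictlyGE
    (((InjectiveObject.ι C).mapHomologicalComplex (.up ℤ)).obj L.obj) n)
  have hGI : DerivedCategory.Plus.IsGE
      ((G.mapHomotopyCategoryPlus ⋙ DerivedCategory.Plus.Qh).obj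
        ((HomotopyCategory.Plus.quotient C).obj I)) n := by
    rw [← DerivedCategory.Plus.isGE_ι_obj_iff]
    exact DerivedCategory.TStructure.t.isGE_of_iso
      ((DerivedCategory.quotientCompQhIso D).symm.app
        ((G.mapHomologicalComplex (.up ℤ)).obj I.obj)) n
  exact DerivedCategory.Plus.TStructure.t.isGE_of_iso e' n

lemma isGE_mapDerivedCategory_obj_iff {C D : Type*} [Category* C] [Category* D]
    [Abelian C] [Abelian D] [HasDerivedCategory C] [HasDerivedCategory D]
    (G : C ⥤ D) [G.Additive] [PreservesFiniteLimits G] [PreservesFiniteColimits G] [G.Faithful]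
    (X : DerivedCategory C) (n : ℤ) :
    (G.mapDerivedCategory.obj X).IsGE n ↔ X.IsGE n := by
  obtain ⟨K, ⟨e⟩⟩ : ∃ K, Nonempty (DerivedCategory.Q.obj K ≅ X) :=
    ⟨_, ⟨DerivedCategory.Q.objObjPreimageIso X⟩⟩
  let e' := G.mapDerivedCategory.mapIso e.symm ≪≫ G.mapDerivedCategoryFactors.app K
  have h₁ : (G.mapDerivedCategory.obj X).IsGE n ↔
      (DerivedCategory.Q.obj ((G.mapHomologicalComplex (.up ℤ)).obj K)).IsGE n :=
    isGE_iff_of_iso DerivedCategory.TStructure.t e' n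
  have h₂ : X.IsGE n ↔ (DerivedCategory.Q.obj K).IsGE n :=
    isGE_iff_of_iso DerivedCategory.TStructure.t e.symm n
  rw [h₁, h₂, DerivedCategory.isGE_Q_obj_iff, DerivedCategory.isGE_Q_obj_iff,
    CochainComplex.isGE_iff, CochainComplex.isGE_iff]
  exact forall₂_congr fun i _ => (K.sc i).exact_map_iff_of_faithful G

lemma isGE_dbToPlus_obj_iff {C : Type u} [Category.{v} C] [Abelian C] [HasDerivedCategory.{w} C]
    {C' : Type u'} [Category.{v} C'] [Abelian C'] [HasDerivedCategory.{w'} C']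
    (J : C ⥤ C') [J.Additive] [PreservesFiniteLimits J] [PreservesFiniteColimits J] [J.Faithful]
    (X : Db C) (n : ℤ) : ((dbToPlus J).obj X).IsGE n ↔ (Db.t C).IsGE X n := by
  rw [← DerivedCategory.Plus.isGE_ι_obj_iff, ObjectProperty.tStructure_isGE_iff]
  exact isGE_mapDerivedCategory_obj_iff J X.obj n

lemma isGE_obj_of_dbToPlus_iso {C : Type u} [Category.{v} C] [Abelian C]
    [HasDerivedCategory.{w} C] {C' : Type u'} [Category.{v} C'] [Abelian C']
    [EnoughInjectives C'] [HasDerivedCategory.{w'} C']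
    (J : C ⥤ C') [J.Additive] [PreservesFiniteLimits J] [PreservesFiniteColimits J] [J.Faithful]
    {D : Type w₁} [Category.{v} D] [Abelian D] [HasDerivedCategory.{w₂} D]
    {D' : Type w₃} [Category.{v} D'] [Abelian D'] [HasDerivedCategory.{w₄} D']
    (I : D ⥤ D') [I.Additive] [PreservesFiniteLimits I] [PreservesFiniteColimits I] [I.Faithful]
    (G : C' ⥤ D') [G.Additive] {F : Db C ⥤ Db D}
    (e : F ⋙ dbToPlus I ≅ dbToPlus J ⋙ G.rightDerivedFunctorPlus)
    (X : Db C) (n : ℤ) [hX : (Db.t C).IsGE X n] : (Db.t D).IsGE (F.obj X) n := by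
  rw [← isGE_dbToPlus_obj_iff J] at hX
  rw [← isGE_dbToPlus_obj_iff I]
  exact (isGE_iff_of_iso DerivedCategory.Plus.TStructure.t (e.app X) n).2
    (isGE_rightDerivedFunctorPlus_obj G _ n)

end LeftExactness

end JMS

end

theorem mainTheorem5_general
    (𝒜 : Type u) [Category.{v} 𝒜] [Abelian 𝒜] [HasDerivedCategory.{w} 𝒜]
    (h𝒜 : ∀ x : 𝒜, IsNoetherianObject x)
    (ℬ : Type u') [Category.{v} ℬ] [Abelian ℬ] [HasDerivedCategory.{w'} ℬ]
    (hℬ : ∀ y : ℬ, IsArtinianObject y)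
    (F : Db 𝒜 ⥤ Db ℬ) [F.CommShift ℤ] [F.IsTriangulated] [F.IsEquivalence]
    (hneg : ∀ (x : 𝒜) (i : ℤ), i < 0 →
      IsZero ((Db.homology ℬ i).obj (F.obj ((Db.single 𝒜).obj x))))
    (hpos : ∀ (x : 𝒜) (i : ℤ), 3 ≤ i →
      IsZero ((Db.homology ℬ i).obj (F.obj ((Db.single 𝒜).obj x)))) :
    let A : ObjectProperty (Db 𝒜) := Db.heart 𝒜
    let B : ObjectProperty (Db 𝒜) := pullbackHeart F
    let E : Fin 3 → ObjectProperty 𝒜 := filtClass F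
    A ≤ (B.extensionProduct (sigma (-1) B)).extensionProduct (sigma (-2) B) ∧
    B ≤ ((sigma 2 A).extensionProduct (sigma 1 A)).extensionProduct A ∧
    (∀ i : ℤ, concentrated F i = (sigma (-i) B).inverseImage (Db.single 𝒜)) ∧
    (∀ i : Fin 3, (E i).IsClosedUnderExtensions) ∧
    (∀ i j : Fin 3, i < j → ∀ x y : 𝒜, E i x → E j y → ∀ f : x ⟶ y, f = 0) ∧
    (∀ x : 𝒜, ∃! p : Subobject x × Subobject x, ∃ h : p.1 ≤ p.2,
      E 0 (subquotient (bot_le : ⊥ ≤ p.1)) ∧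
      E 1 (subquotient h) ∧
      E 2 (subquotient (le_top : p.2 ≤ ⊤))) := by
  intro A B E
  have htilt : IsTilt (Db.t 𝒜) (tStructurePullback F (Db.t ℬ)) 2 :=
    isTilt_of_isZero_homology F hneg hpos
  have hA : A = (Db.t 𝒜).heart := Db.heart_eq
  have hB : B = (tStructurePullback F (Db.t ℬ)).heart := pullbackHeart_eq F
  rw [hA, hB]
  refine ⟨htilt.heart_le_extensionProduct, htilt.heart_le_extensionProduct_symm, fun i => ?_,
    isClosedUnderExtensions_filtClass F,
    fun i j hij x y hx hy f => filtClass_le_leftOrthogonal F hij x hx f hy, fun x => ?_⟩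
  · rw [concentrated_eq, sigma_heart _ (-i) i (by lia)]
  · have := h𝒜 x
    exact existsUnique_filtration F htilt hℬ x

theorem mainTheorem5
    (k : Type w) [Field k]
    (𝒜 : Type u) [Category.{v} 𝒜] [Abelian 𝒜] [Linear k 𝒜] [∀ X Y : 𝒜, Module.Finite k (X ⟶ Y)]
    (𝒜' : Type u') [Category.{v} 𝒜'] [Abelian 𝒜'] [IsGrothendieckAbelian.{v} 𝒜']
    (hgen : (isNoetherianObject (C := 𝒜')).IsSeparating)
    (J : 𝒜 ⥤ 𝒜') [J.Full] [J.Faithful] [J.Additive]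
    [PreservesFiniteLimits J] [PreservesFiniteColimits J]
    (hJ : J.essImage = isNoetherianObject)
    (T : 𝒜)
    [HasDerivedCategory.{w₁} 𝒜] [HasDerivedCategory.{w₂} 𝒜']
    [HasDerivedCategory.{w₃} (ModEndOp k T)]
    [HasDerivedCategory.{w₄} (ModuleCat.{v} (End T)ᵐᵒᵖ)]
    (F : Db 𝒜 ⥤ Db (ModEndOp k T))
    [F.CommShift ℤ] [F.IsTriangulated] [F.IsEquivalence]
    (hF : Nonempty (F ⋙ dbToPlus (ModEndOp.ι k T) ≅ dbToPlus J ⋙ rHom J T))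
    (hpd : ∀ (X : 𝒜) (i : ℤ), 3 ≤ i →
      IsZero ((Db.homology (ModEndOp k T) i).obj (F.obj ((Db.single 𝒜).obj X)))) :
    let A : ObjectProperty (Db 𝒜) := Db.heart 𝒜
    let B : ObjectProperty (Db 𝒜) := pullbackHeart F
    let E : Fin 3 → ObjectProperty 𝒜 := filtClass F
    A ≤ (B.extensionProduct (sigma (-1) B)).extensionProduct (sigma (-2) B) ∧
    B ≤ ((sigma 2 A).extensionProduct (sigma 1 A)).extensionProduct A ∧
    (∀ i : ℤ, concentrated F i = (sigma (-i) B).inverseImage (Db.single 𝒜)) ∧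
    (∀ i : Fin 3, (E i).IsClosedUnderExtensions) ∧
    (∀ i j : Fin 3, i < j → ∀ x y : 𝒜, E i x → E j y → ∀ f : x ⟶ y, f = 0) ∧
    (∀ x : 𝒜, ∃! p : Subobject x × Subobject x, ∃ h : p.1 ≤ p.2,
      E 0 (subquotient (bot_le : ⊥ ≤ p.1)) ∧
      E 1 (subquotient h) ∧
      E 2 (subquotient (le_top : p.2 ≤ ⊤))) := by
  obtain ⟨e⟩ := hF
  have h𝒜 (x : 𝒜) : IsNoetherianObject x :=
    have : IsNoetherianObject (J.obj x) := ⟨hJ ▸ J.obj_mem_essImage x⟩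
    isNoetherianObject_of_map J x
  have hneg (x : 𝒜) : (Db.t (ModEndOp k T)).IsGE (F.obj ((Db.single 𝒜).obj x)) 0 :=
    have := isGE_obj_of_essImage Db.essImage_single x
    isGE_obj_of_dbToPlus_iso J (ModEndOp.ι k T) (homFunctor J T) e _ 0
  exact mainTheorem5_general 𝒜 h𝒜 (ModEndOp k T) (ModEndOp.isArtinianObject k) F
    (fun x => (Db.isGE_iff _ 0).1 (hneg x)) hpd
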